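/- Let $(M^n,g)$ be a compact smooth Riemannian manifold without boundary, let $f\in C^\infty(M)$ and $\tilde g=e^{2f}g$, and let $\Sigma^k\subset M$ be a closed (compact, without boundary) embedded smooth $k$-dimensional submanifold. For a section $V$ of the normal bundle $N\Sigma$ (it is the same for $g$ and $\tilde g$) define at each point of $\Sigma$ $$q^\Sigma(V,V)=\sum_{i=1}^k|\nabla^\perp_{E_i}V|_g^2-\sum_{i=1}^k g\big(R_M(V,E_i)V,E_i\big)-\sum_{i,j=1}^k g\big(A(E_i,E_j),V\big)^2 ,$$ where $\{E_i\}_{i=1}^k$ is a $g$-orthonormal basis of the tangent space of $\Sigma$, $\nabla$ is the Levi-Civita connection of $g$, $\nabla^\perp_XV=(\nabla_XV)^\perp$ is the normal connection, $A(X,Y)=(\nabla_XY)^\perp$ is the second fundamental form, and $R_M(X,Y)Z=\nabla_Y\nabla_XZ-\nabla_X\nabla_YZ+\nabla_{[X,Y]}Z$. Let $\tilde q^\Sigma$ be defined in the same way from $\tilde g$. Assume that $\Sigma$ is minimal with respect to $\tilde g$, i.e. its mean curvature vector $\tilde H$ (the $\tilde g$-trace over $\Sigma$ of the second fundamental form $\tilde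 A$ of $\Sigma$ in $(M,\tilde g)$) vanishes. Then for every smooth section $V$ of $N\Sigma$, with $\tilde V=e^{-f}V$, at every point of $\Sigma$ $$\tilde q^\Sigma(\tilde V,\tilde V)=q^\Sigma(V,V)e^{-2f}-|\nabla^\top f|_g^2|V|_g^2e^{-2f}+k\,\mathrm{Hess} f(V,V)e^{-2f}+k|\nabla f|_g^2|V|_g^2e^{-2f}+\mathrm{div}_\Sigma(\nabla f)|V|_g^2e^{-2f}.$$ Here $\nabla f$ is the $g$-gradient of $f$, $\nabla^\top f$ its component tangent to $\Sigma$, $\mathrm{Hess} f(X,Y)=g(\nabla_Y\nabla f,X)$ and $\mathrm{div}_\Sigma(\nabla f)=\sum_{i=1}^k g(\nabla_{E_i}\nabla f,E_i)$. -/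

import Mathlib

open scoped Manifold ContDiff Bundle

noncomputable section

namespace ConformalVariation

/-- Euclidean space of dimension `n`, the model of all `n`-manifolds below. -/
abbrev Euc (n : ℕ) : Type := EuclideanSpace ℝ (Fin n)

/-! ### Traces with respect to a scalar product -/

/-- The trace `∑ i j, h^{ij} B(b_i, b_j)` of `B` with respect to the scalar product `h`, where `b` is
the standard basis and `h^{ij}` the inverse matrix of `h(b_i, b_j)`. The vector
`∑ j, h^{ij} b_j` is `h⁻¹` applied to the `i`-th coordinate functional. For bilinear `B` this is
`∑ i, B(e_i, e_i)` for every `h`-orthonormal basis `e`, see `metricTrace_eq_sum_orthonormal`. -/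
def metricTrace {k : ℕ} {W : Type*} [AddCommMonoid W] (h : Euc k →L[ℝ] Euc k →L[ℝ] ℝ)
    (B : Euc k → Euc k → W) : W :=
  ∑ i, B (EuclideanSpace.single i 1) (h.inverse (EuclideanSpace.proj i))

theorem metricTrace_eq_sum_orthonormal {k : ℕ} {W : Type*} [AddCommGroup W] [Module ℝ W]
    (h : Euc k →L[ℝ] Euc k →L[ℝ] ℝ) (B : Euc k →ₗ[ℝ] Euc k →ₗ[ℝ] W)
    (e : Fin k → Euc k) (he : ∀ i j, h (e i) (e j) = if i = j then 1 else 0) :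
    metricTrace h (fun u v => B u v) = ∑ i, B (e i) (e i) := by
  classical
  have hli : LinearIndependent ℝ e := by
    rw [Fintype.linearIndependent_iff]
    intro c hc j
    have h1 := congrArg (fun x => h x (e j)) hc
    simpa [map_sum, he] using h1
  let b : Module.Basis (Fin k) ℝ (Euc k) :=
    basisOfLinearIndependentOfCardEqFinrank' e hli (by simp)
  have hb : ∀ i, b i = e i := fun i => by simp [b]
  have expand : ∀ v : Euc k, v = ∑ i, h v (e i) • e i := by
    intro v
    have h2 : ∀ i, b.repr v i = h v (e i) := by
      intro i
      conv_rhs => rw [← b.sum_repr v]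
      simp [map_sum, hb, he]
    conv_lhs => rw [← b.sum_repr v]
    simp [h2, hb]
  have hinj : Function.Injective h := by
    rw [injective_iff_map_eq_zero]
    intro v hv
    rw [expand v]
    simp [hv]
  have hinv : h.IsInvertible := by
    let L : Euc k ≃ₗ[ℝ] (Euc k →L[ℝ] ℝ) :=
      LinearEquiv.ofInjectiveOfFinrankEq (h : Euc k →ₗ[ℝ] (Euc k →L[ℝ] ℝ)) hinj (by
        rw [← (LinearMap.toContinuousLinearMap : (Euc k →ₗ[ℝ] ℝ) ≃ₗ[ℝ] _).finrank_eq]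
        simp)
    refine ⟨L.toContinuousLinearEquiv, ?_⟩
    ext v w
    rfl
  have hr : ∀ i, h.inverse (EuclideanSpace.proj i) = ∑ j, (e j i) • e j := by
    intro i
    apply hinj
    obtain ⟨L, rfl⟩ := hinv
    ext w
    have : (L : Euc k →L[ℝ] Euc k →L[ℝ] ℝ) ((L : Euc k →L[ℝ] Euc k →L[ℝ] ℝ).inverse
        (EuclideanSpace.proj i)) = EuclideanSpace.proj i := by simp
    rw [this]
    conv_lhs => rw [expand w]
    have hs : ∀ u v, (L : Euc k →L[ℝ] Euc k →L[ℝ] ℝ) u v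
        = (L : Euc k →L[ℝ] Euc k →L[ℝ] ℝ) v u := by
      intro u v
      conv_lhs => rw [expand u, expand v]
      conv_rhs => rw [expand u, expand v]
      simp only [map_sum, map_smul, _root_.sum_apply, _root_.smul_apply,
        he, smul_eq_mul]
      simp [mul_comm]
    simp only [map_sum, map_smul, _root_.sum_apply, _root_.smul_apply,
      smul_eq_mul]
    refine Finset.sum_congr rfl fun j _ => ?_
    rw [hs w (e j)]
    simp [mul_comm]
  unfold metricTrace
  simp only [hr, map_sum, map_smul]
  rw [Finset.sum_comm]
  refine Finset.sum_congr rfl fun j _ => ?_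
  have : e j = ∑ i, (e j i) • EuclideanSpace.single i (1 : ℝ) := by
    ext l
    simp [Finset.sum_apply, Pi.single_apply]
  have h3 : B (e j) (e j) = B (∑ i, (e j i) • EuclideanSpace.single i (1 : ℝ)) (e j) := by
    rw [← this]
  rw [h3]
  simp only [map_sum, map_smul, LinearMap.sum_apply, LinearMap.smul_apply]

/-! ### Riemannian geometry of a metric `G` on an open subset of Euclidean space -/

/-- The Christoffel symbols `Γ(u, v)` of `G` at `y`, characterized by
`G(Γ(u, v), w) = (∂_u G(v, w) + ∂_v G(u, w) - ∂_w G(u, v)) / 2`. -/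
def christoffel {n : ℕ} (G : Euc n → Euc n →L[ℝ] Euc n →L[ℝ] ℝ) (y u v : Euc n) : Euc n :=
  (G y).inverse ((1 / 2 : ℝ) •
    (fderiv ℝ G y u v + fderiv ℝ G y v u - ((fderiv ℝ G y).flip u).flip v))

/-- The Levi-Civita derivative `∇_X Y` of vector fields on an open subset of Euclidean space. -/
def flatCovDeriv {n : ℕ} (G : Euc n → Euc n →L[ℝ] Euc n →L[ℝ] ℝ) (X Y : Euc n → Euc n) :
    Euc n → Euc n :=
  fun y => fderiv ℝ Y y (X y) + christoffel G y (X y) (Y y)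

/-- The Riemann tensor `∇_Y ∇_X Z - ∇_X ∇_Y Z + ∇_{[X,Y]} Z`. -/
def flatCurvature {n : ℕ} (G : Euc n → Euc n →L[ℝ] Euc n →L[ℝ] ℝ) (X Y Z : Euc n → Euc n) :
    Euc n → Euc n :=
  flatCovDeriv G Y (flatCovDeriv G X Z) - flatCovDeriv G X (flatCovDeriv G Y Z)
    + flatCovDeriv G (VectorField.lieBracket ℝ X Y) Z

section

variable {n k : ℕ}
  {M : Type*} [TopologicalSpace M] [ChartedSpace (Euc n) M] [IsManifold (𝓡 n) ∞ M]
  {S : Type*} [TopologicalSpace S] [ChartedSpace (Euc k) S] [IsManifold (𝓡 k) ∞ S]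

variable (n M) in
/-- Smooth Riemannian metrics on the `n`-manifold `M`. -/
abbrev Metric : Type _ :=
  Bundle.ContMDiffRiemannianMetric (𝓡 n) ∞ (Euc n) (fun x : M => TangentSpace (𝓡 n) x)

set_option synthInstance.maxHeartbeats 400000 in
/-- The conformal metric `e^{2f} g`. -/
def Metric.conformal (g : Metric n M) (f : M → ℝ) (hf : ContMDiff (𝓡 n) 𝓘(ℝ, ℝ) ∞ f) :
    Metric n M where
  inner x := Real.exp (2 * f x) • g.inner x
  symm x v w := by simp [g.symm x v w]
  pos x v hv := by
    have := g.pos x v hv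
    simp only [_root_.smul_apply, smul_eq_mul]
    positivity
  isVonNBounded x := by
    have h := (g.isVonNBounded x).image
      (Real.exp (-f x) • ContinuousLinearMap.id ℝ (TangentSpace (𝓡 n) x))
    refine h.subset ?_
    intro v hv
    refine ⟨Real.exp (f x) • v, ?_, ?_⟩
    · simp only [Set.mem_ofPred_eq, _root_.smul_apply, smul_eq_mul, map_smul] at hv ⊢
      rw [← mul_assoc, ← Real.exp_add, ← two_mul]
      exact hv
    · simp [smul_smul, ← Real.exp_add]
  contMDiff := by
    have h1 : ContMDiff (𝓡 n) 𝓘(ℝ, ℝ) ∞ (fun x => Real.exp (2 * f x)) :=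
      (Real.contDiff_exp.comp (contDiff_const.mul contDiff_id)).contMDiff.comp hf
    exact h1.smul_section g.contMDiff

/-- The scalar product `g_x`. In Mathlib the type of tangent vectors at `x` is by definition the model
space: a tangent vector is the vector of its coordinates in the chart at `x`. -/
def Metric.form (g : Metric n M) (x : M) : Euc n →L[ℝ] Euc n →L[ℝ] ℝ := g.inner x

/-- The metric in the chart at `x`: the pull-back of `g` under the inverse of the chart. -/
def Metric.inChart (g : Metric n M) (x : M) (y : Euc n) : Euc n →L[ℝ] Euc n →L[ℝ] ℝ :=
  let D : Euc n →L[ℝ] Euc n := mfderiv 𝓘(ℝ, Euc n) (𝓡 n) (extChartAt (𝓡 n) x).symm y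
  (g.form ((extChartAt (𝓡 n) x).symm y)).bilinearComp D D

/-- The Riemann tensor `R(u, v) w` at `x`, computed in the chart at `x` on the vector fields with
constant coordinates `u, v, w`; with the sign for which `g(R(u, v) u, v)` is the sectional curvature
of the plane of two orthonormal vectors `u, v`. -/
def Metric.curvature (g : Metric n M) (x : M) (u v w : TangentSpace (𝓡 n) x) :
    TangentSpace (𝓡 n) x :=
  flatCurvature (g.inChart x) (fun _ => u) (fun _ => v) (fun _ => w) (extChartAt (𝓡 n) x x)

/-- The Levi-Civita covariant derivative `∇_u Y` at `q`, in direction `u ∈ T_q S`, of a vector field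
`Y` along a map `F : S → M`, i.e. the covariant derivative of the pulled back tangent bundle. In the
chart of `M` at `F q` it is `∂_u Y + Γ(dF u, Y)`. -/
def Metric.covDerivAlong (g : Metric n M) (F : S → M) (Y : ∀ q : S, TangentSpace (𝓡 n) (F q))
    (q : S) (u : TangentSpace (𝓡 k) q) : TangentSpace (𝓡 n) (F q) :=
  mvfderiv (𝓡 k)
      (fun q' : S => (mvfderiv (𝓡 n) (extChartAt (𝓡 n) (F q)) (F q') (Y q') : Euc n)) q u
    + christoffel (g.inChart (F q)) (extChartAt (𝓡 n) (F q) (F q))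
        (mfderiv (𝓡 k) (𝓡 n) F q u) (Y q)

/-- The Levi-Civita covariant derivative `∇_u Y` of a vector field on `M`. -/
def Metric.covDeriv (g : Metric n M) (Y : ∀ x : M, TangentSpace (𝓡 n) x)
    (x : M) (u : TangentSpace (𝓡 n) x) : TangentSpace (𝓡 n) x :=
  g.covDerivAlong (id : M → M) Y x u

/-- The gradient `∇f`: `g(∇f, v) = df(v)`. -/
def Metric.grad (g : Metric n M) (f : M → ℝ) (x : M) : TangentSpace (𝓡 n) x :=
  (g.inner x).inverse (mvfderiv (𝓡 n) f x)

/-- The Hessian `Hess f(u, v) = g(∇_v ∇f, u)`. -/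
def Metric.hess (g : Metric n M) (f : M → ℝ) (x : M) (u v : TangentSpace (𝓡 n) x) : ℝ :=
  g.inner x (g.covDeriv (g.grad f) x v) u

/-! ### Submanifolds `Σ ⊂ M`, given by the inclusion `ι : S → M` -/

variable (k)

/-- The differential `T_p Σ → T_p M` of the inclusion. -/
def diffl (ι : S → M) (p : S) : Euc k →L[ℝ] Euc n :=
  mfderiv (𝓡 k) (𝓡 n) ι p

/-- The metric induced on `Σ`. -/
def Metric.induced (g : Metric n M) (ι : S → M) (p : S) :
    Euc k →L[ℝ] Euc k →L[ℝ] ℝ :=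
  (g.form (ι p)).bilinearComp (diffl k ι p) (diffl k ι p)

/-- The trace over `T_p Σ` with respect to the metric induced by `g`. -/
def Metric.trace (g : Metric n M) (ι : S → M) (p : S) {W : Type*} [AddCommMonoid W]
    (B : TangentSpace (𝓡 k) p → TangentSpace (𝓡 k) p → W) : W :=
  metricTrace (g.induced k ι p) B

/-- The tangential part `X^⊤` of `X ∈ T_p M`, `p ∈ Σ`: the vector of `T_p Σ` which has the same
scalar products as `X` with all vectors of `T_p Σ`. -/
def Metric.tangential (g : Metric n M) (ι : S → M) (p : S) (X : TangentSpace (𝓡 n) (ι p)) :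
    TangentSpace (𝓡 n) (ι p) :=
  diffl k ι p
    ((g.induced k ι p).inverse ((g.form (ι p) X).comp (diffl k ι p)))

/-- The normal part `X^⊥`. -/
def Metric.normal (g : Metric n M) (ι : S → M) (p : S) (X : TangentSpace (𝓡 n) (ι p)) :
    TangentSpace (𝓡 n) (ι p) :=
  X - g.tangential k ι p X

/-- Smooth sections of the normal bundle of `Σ`. -/
structure Metric.IsNormalSection (g : Metric n M) (ι : S → M)
    (V : ∀ p : S, TangentSpace (𝓡 n) (ι p)) : Prop where
  contMDiff : ContMDiff (𝓡 k) (𝓡 n).tangent ∞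
    (fun p => (⟨ι p, V p⟩ : TangentBundle (𝓡 n) M))
  inner_eq_zero : ∀ (p : S) (u : TangentSpace (𝓡 k) p),
    g.form (ι p) (V p) (diffl k ι p u) = 0

/-- The second fundamental form `A(u, v) = (∇_u v)^⊥`, where `v` is extended to a vector field
tangent to `Σ`. -/
def Metric.secondForm (g : Metric n M) (ι : S → M) (p : S) (u v : TangentSpace (𝓡 k) p) :
    TangentSpace (𝓡 n) (ι p) :=
  g.normal k ι p (g.covDerivAlong ι
    (fun q => diffl k ι q (FiberBundle.extend (Euc k) v q)) p u)

/-- The mean curvature vector, the trace of the second fundamental form. -/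
def Metric.meanCurvature (g : Metric n M) (ι : S → M) (p : S) : TangentSpace (𝓡 n) (ι p) :=
  g.trace k ι p (g.secondForm k ι p)

/-- `Σ` is minimal: its mean curvature vector vanishes. -/
def Metric.IsMinimal (g : Metric n M) (ι : S → M) : Prop :=
  ∀ p, g.meanCurvature k ι p = 0

/-- The connection `∇^⊥_u V = (∇_u V)^⊥` of the normal bundle. -/
def Metric.normalDeriv (g : Metric n M) (ι : S → M) (V : ∀ p : S, TangentSpace (𝓡 n) (ι p))
    (p : S) (u : TangentSpace (𝓡 k) p) : TangentSpace (𝓡 n) (ι p) :=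
  g.normal k ι p (g.covDerivAlong ι V p u)

/-- `div_Σ X = ∑ i, g(∇_{E_i} X, E_i)` for a vector field `X` on `M`. -/
def Metric.divAlong (g : Metric n M) (ι : S → M) (X : ∀ x : M, TangentSpace (𝓡 n) x) (p : S) : ℝ :=
  g.trace k ι p fun u v =>
    g.form (ι p) (g.covDeriv X (ι p) (diffl k ι p u)) (diffl k ι p v)

/-- The second variation integrand
`q(V, V) = |∇^⊥ V|² - tr_Σ (R(V, ·) V) - |g(A(·, ·), V)|²`. -/
def Metric.secondVariation (g : Metric n M) (ι : S → M) (V : ∀ p : S, TangentSpace (𝓡 n) (ι p))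
    (p : S) : ℝ :=
  g.trace k ι p (fun u v => g.form (ι p) (g.normalDeriv k ι V p u) (g.normalDeriv k ι V p v))
    - g.trace k ι p (fun u v =>
        g.form (ι p) (g.curvature (ι p) (V p) (diffl k ι p u) (V p))
          (diffl k ι p v))
    - g.trace k ι p (fun u u' => g.trace k ι p (fun v v' =>
        g.form (ι p) (g.secondForm k ι p u v) (V p)
          * g.form (ι p) (g.secondForm k ι p u' v') (V p)))

end

end ConformalVariation

end

/-!
At a point `x` of `M` everything is computed in the chart at `x`, where the metric becomes a field
`G` of scalar products on an open set and `e^{2f} g` becomes `e^{2F} G`. There the Levi-Civita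
connections differ by an explicit tensor (`christoffel_conformal`),
`Γ̃(u, v) = Γ(u, v) + dF(u) v + dF(v) u - G(u, v) ∇F`.
Differentiating this identity, and using that the connection of `G` is metric, gives the conformal
change of the curvature; for `u, w` orthogonal to `v` (`form_flatCurvature_conformal`)
`G(R̃(v, u) v, w) = G(R(v, u) v, w) - Hess F(v, v) G(u, w) - Hess F(u, w) |v|² + dF(v)² G(u, w)
  + dF(u) dF(w) |v|² - |∇F|² |v|² G(u, w)`.

Along the submanifold the same formula for `Γ̃` shows:

* `∇̃_u (e^{-f} V)` is `e^{-f} ∇_u V` up to a tangential vector, as `V` is normal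
  (`covAlong_conformal`), so the first term of the integrand is just multiplied by `e^{-2f}`;
* `Ã(u, v) = A(u, v) - g(u, v) (∇f)^⊥` (`secondFormBilin_conformal`). Minimality for `e^{2f} g` thus
  means `tr A = k (∇f)^⊥` (`metricTrace_secondFormBilin_of_isMinimal`), and then
  `|g(A, V) - df(V) g|² = |g(A, V)|² - k df(V)²`.

In the sum, the terms `k df(V)²` from the curvature and from the second fundamental form cancel, and
what is left is the claim.
-/

open scoped Manifold ContDiff Bundle

noncomputable section

namespace ConformalVariation

-- Norms on iterated spaces of linear maps are not found at the default depth.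
set_option maxSynthPendingDepth 3

/-! ### Linear algebra of the trace -/

theorem inverse_smul_of_ne_zero {E F : Type*} [NormedAddCommGroup E] [NormedSpace ℝ E]
    [NormedAddCommGroup F] [NormedSpace ℝ F] {h : E →L[ℝ] F} (hh : h.IsInvertible) {c : ℝ}
    (hc : c ≠ 0) : (c • h).inverse = c⁻¹ • h.inverse := by
  apply ContinuousLinearMap.inverse_eq
  · ext v
    simp [hh.self_apply_inverse, smul_smul, hc]
  · ext v
    simp [hh.inverse_apply_self, smul_smul, hc]

theorem isInvertible_of_pos {m : ℕ} {h : Euc m →L[ℝ] Euc m →L[ℝ] ℝ}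
    (hpos : ∀ v, v ≠ 0 → 0 < h v v) : h.IsInvertible := by
  have hinj : Function.Injective h := by
    rw [injective_iff_map_eq_zero]
    intro v hv
    by_contra hne
    have := hpos v hne
    simp [hv] at this
  let L : Euc m ≃ₗ[ℝ] (Euc m →L[ℝ] ℝ) :=
    LinearEquiv.ofInjectiveOfFinrankEq (h : Euc m →ₗ[ℝ] (Euc m →L[ℝ] ℝ)) hinj (by
      rw [← (LinearMap.toContinuousLinearMap : (Euc m →ₗ[ℝ] ℝ) ≃ₗ[ℝ] _).finrank_eq]
      simp)
  exact ⟨L.toContinuousLinearEquiv, by ext v w; rfl⟩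

section Trace

variable {k : ℕ} {W : Type*} [AddCommGroup W] [Module ℝ W] {h : Euc k →L[ℝ] Euc k →L[ℝ] ℝ}

/-- The trace with respect to `c h` is `c⁻¹` times the trace with respect to `h`. -/
theorem metricTrace_smul_form (hh : h.IsInvertible) {c : ℝ} (hc : c ≠ 0)
    {B : Euc k → Euc k → W} (hB : ∀ (t : ℝ) u v, B u (t • v) = t • B u v) :
    metricTrace (c • h) B = c⁻¹ • metricTrace h B := by
  simp [metricTrace, inverse_smul_of_ne_zero hh hc, Finset.smul_sum, hB]

theorem map_metricTrace {W' : Type*} [AddCommGroup W'] [Module ℝ W'] (φ : W →ₗ[ℝ] W')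
    (B : Euc k → Euc k → W) : φ (metricTrace h B) = metricTrace h (fun u v => φ (B u v)) := by
  simp [metricTrace]

theorem metricTrace_add (B B' : Euc k → Euc k → ℝ) :
    metricTrace h (fun u v => B u v + B' u v) = metricTrace h B + metricTrace h B' := by
  simp [metricTrace, Finset.sum_add_distrib]

theorem metricTrace_sub (B B' : Euc k → Euc k → ℝ) :
    metricTrace h (fun u v => B u v - B' u v) = metricTrace h B - metricTrace h B' := by
  simp [metricTrace, Finset.sum_sub_distrib]

theorem metricTrace_smul (c : ℝ) (B : Euc k → Euc k → W) :
    metricTrace h (fun u v => c • B u v) = c • metricTrace h B := by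
  simp [metricTrace, Finset.smul_sum]

theorem metricTrace_const_mul (c : ℝ) (B : Euc k → Euc k → ℝ) :
    metricTrace h (fun u v => c * B u v) = c * metricTrace h B :=
  metricTrace_smul c B

theorem metricTrace_mul_const (c : ℝ) (B : Euc k → Euc k → ℝ) :
    metricTrace h (fun u v => B u v * c) = metricTrace h B * c := by
  simp [metricTrace, Finset.sum_mul]

theorem functional_eq_sum_proj (α : Euc k →L[ℝ] ℝ) :
    α = ∑ i, α (EuclideanSpace.single i 1) • (EuclideanSpace.proj i : Euc k →L[ℝ] ℝ) := by
  ext v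
  conv_lhs => rw [show v = ∑ i, v i • EuclideanSpace.single i (1 : ℝ) by
    ext l; simp [Finset.sum_apply, Pi.single_apply]]
  simp [mul_comm]

/-- Tracing against `h(u, ·)` evaluates at `u`, as for the sum of `h(u, e_i) b(e_i)` over an
orthonormal basis. -/
theorem metricTrace_form_left (hh : h.IsInvertible) (u : Euc k) (b : Euc k →ₗ[ℝ] W) :
    metricTrace h (fun v v' => h u v • b v') = b u := by
  conv_rhs => rw [← hh.inverse_apply_self u, functional_eq_sum_proj (h u)]
  simp [metricTrace]

/-- The trace of `α ⊗ β` is the scalar product of `α` and `β` in the dual metric. -/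
theorem metricTrace_functional (α β : Euc k →L[ℝ] ℝ) :
    metricTrace h (fun v v' => α v * β v') = β (h.inverse α) := by
  conv_rhs => rw [functional_eq_sum_proj α]
  simp [metricTrace]

/-- The counterpart of `metricTrace_form_left` in the other argument. It needs the symmetry of `h`,
because `metricTrace` raises the index of the first argument only. -/
theorem metricTrace_form_right (hh : h.IsInvertible) (hs : ∀ u v, h u v = h v u) (u : Euc k)
    (b : Euc k →ₗ[ℝ] W) :
    metricTrace h (fun v v' => h u v' • b v) = b u := by
  conv_rhs => rw [show u = ∑ i, u i • EuclideanSpace.single i (1 : ℝ) by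
    ext l; simp [Finset.sum_apply, Pi.single_apply]]
  simp [metricTrace, hs u, hh.self_apply_inverse]

theorem metricTrace_form (hh : h.IsInvertible) (hs : ∀ u v, h u v = h v u) :
    metricTrace h (fun u v => h u v) = k := by
  simp [metricTrace, hs _ (h.inverse _), hh.self_apply_inverse]

/-- The trace does not see the order of the arguments, as the inverse matrix of a symmetric `h` is
symmetric. -/
theorem metricTrace_flip (hh : h.IsInvertible) (hs : ∀ u v, h u v = h v u)
    (a : Euc k →ₗ[ℝ] Euc k →ₗ[ℝ] W) :
    metricTrace h (fun u v => a v u) = metricTrace h (fun u v => a u v) := by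
  have hm : ∀ i j, h.inverse (EuclideanSpace.proj i) j = h.inverse (EuclideanSpace.proj j) i := by
    intro i j
    have h1 : ∀ i j, h.inverse (EuclideanSpace.proj i) j
        = h (h.inverse (EuclideanSpace.proj j)) (h.inverse (EuclideanSpace.proj i)) := by
      intro i j
      simp [hh.self_apply_inverse]
    rw [h1, h1, hs]
  have he : ∀ i, h.inverse (EuclideanSpace.proj i)
      = ∑ j, h.inverse (EuclideanSpace.proj i) j • EuclideanSpace.single j (1 : ℝ) := by
    intro i
    ext l
    simp [Finset.sum_apply, Pi.single_apply]
  unfold metricTrace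
  have h2 : ∀ i, a (h.inverse (EuclideanSpace.proj i)) (EuclideanSpace.single i 1)
      = ∑ j, h.inverse (EuclideanSpace.proj i) j •
        a (EuclideanSpace.single j 1) (EuclideanSpace.single i 1) := by
    intro i
    conv_lhs => rw [he i]
    simp
  have h3 : ∀ i, a (EuclideanSpace.single i 1) (h.inverse (EuclideanSpace.proj i))
      = ∑ j, h.inverse (EuclideanSpace.proj i) j •
        a (EuclideanSpace.single i 1) (EuclideanSpace.single j 1) := by
    intro i
    conv_lhs => rw [he i]
    simp
  simp only [h2, h3]
  rw [Finset.sum_comm]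
  exact Finset.sum_congr rfl fun i _ => Finset.sum_congr rfl fun j _ => by rw [hm]

/-- The squared norm of `a - c h` with respect to `h`. Its cross term is the trace of `a`, and the
squared norm of `h` itself is the dimension `k`. -/
theorem metricTrace_sq_sub_smul_form (hh : h.IsInvertible) (hs : ∀ u v, h u v = h v u)
    (a : Euc k →ₗ[ℝ] Euc k →ₗ[ℝ] ℝ) (c : ℝ) :
    metricTrace h (fun u u' => metricTrace h (fun v v' =>
        (a u v - c * h u v) * (a u' v' - c * h u' v')))
      = metricTrace h (fun u u' => metricTrace h (fun v v' => a u v * a u' v'))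
        - 2 * c * metricTrace h (fun u v => a u v) + c ^ 2 * k := by
  have inner : ∀ u u', metricTrace h (fun v v' =>
        (a u v - c * h u v) * (a u' v' - c * h u' v'))
      = metricTrace h (fun v v' => a u v * a u' v') - c * a u u' - c * a u' u
        + c ^ 2 * h u u' := by
    intro u u'
    have e1 := metricTrace_form_right hh hs u' (a u)
    have e2 := metricTrace_form_left hh u (a u')
    have e3 := metricTrace_form_left hh u (h u').toLinearMap
    simp only [smul_eq_mul, ContinuousLinearMap.coe_coe] at e1 e2 e3
    rw [← e1, ← e2, hs u u', ← e3, ← metricTrace_const_mul, ← metricTrace_const_mul,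
      ← metricTrace_const_mul, ← metricTrace_sub, ← metricTrace_sub, ← metricTrace_add]
    congr 1
    funext v v'
    ring
  simp only [inner]
  rw [metricTrace_add, metricTrace_sub, metricTrace_sub, metricTrace_const_mul,
    metricTrace_const_mul, metricTrace_const_mul, metricTrace_flip hh hs, metricTrace_form hh hs]
  ring

end Trace

/-! ### Conformal change of the Christoffel symbols -/

section
open Filter Topology

variable {n : ℕ} {G : Euc n → Euc n →L[ℝ] Euc n →L[ℝ] ℝ} {F : Euc n → ℝ} {y : Euc n}

theorem christoffel_add_left (G : Euc n → Euc n →L[ℝ] Euc n →L[ℝ] ℝ) (y u u' v : Euc n) :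
    christoffel G y (u + u') v = christoffel G y u v + christoffel G y u' v := by
  unfold christoffel
  rw [← map_add]
  congr 1
  ext w
  simp
  ring

theorem christoffel_add_right (G : Euc n → Euc n →L[ℝ] Euc n →L[ℝ] ℝ) (y u v v' : Euc n) :
    christoffel G y u (v + v') = christoffel G y u v + christoffel G y u v' := by
  unfold christoffel
  rw [← map_add]
  congr 1
  ext w
  simp
  ring

theorem christoffel_smul_left (G : Euc n → Euc n →L[ℝ] Euc n →L[ℝ] ℝ) (y : Euc n) (c : ℝ)
    (u v : Euc n) : christoffel G y (c • u) v = c • christoffel G y u v := by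
  unfold christoffel
  rw [← map_smul]
  congr 1
  ext w
  simp
  ring

theorem christoffel_smul_right (G : Euc n → Euc n →L[ℝ] Euc n →L[ℝ] ℝ) (y : Euc n) (c : ℝ)
    (u v : Euc n) : christoffel G y u (c • v) = c • christoffel G y u v := by
  unfold christoffel
  rw [← map_smul]
  congr 1
  ext w
  simp
  ring

theorem christoffel_sub_right (G : Euc n → Euc n →L[ℝ] Euc n →L[ℝ] ℝ) (y u v v' : Euc n) :
    christoffel G y u (v - v') = christoffel G y u v - christoffel G y u v' := by
  have := christoffel_add_right G y u v (-v')
  rw [← sub_eq_add_neg, ← neg_one_smul ℝ v', christoffel_smul_right] at this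
  rw [this, neg_one_smul, sub_eq_add_neg]

/-- The Koszul formula. -/
theorem form_christoffel (hinv : (G y).IsInvertible) (u v w : Euc n) :
    G y (christoffel G y u v) w = (1 / 2 : ℝ) *
      (fderiv ℝ G y u v w + fderiv ℝ G y v u w - fderiv ℝ G y w u v) := by
  simp [christoffel, hinv.self_apply_inverse]

theorem fderiv_form_symm (hG : DifferentiableAt ℝ G y)
    (hs : ∀ᶠ z in 𝓝 y, ∀ u v, G z u v = G z v u) (a u v : Euc n) :
    fderiv ℝ G y a u v = fderiv ℝ G y a v u := by
  have key := fun p q : Euc n => (hG.hasFDerivAt.clm_apply (hasFDerivAt_const p y)).clm_apply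
    (hasFDerivAt_const q y)
  have h1 := (key u v).unique ((key v u).congr_of_eventuallyEq (hs.mono fun z hz => hz u v))
  simpa using congrArg (fun L => L a) h1

theorem christoffel_symm (hG : DifferentiableAt ℝ G y)
    (hs : ∀ᶠ z in 𝓝 y, ∀ u v, G z u v = G z v u) (u v : Euc n) :
    christoffel G y u v = christoffel G y v u := by
  unfold christoffel
  congr 1
  ext w
  simp [fderiv_form_symm hG hs w u v]
  ring

/-- The Levi-Civita connection is metric: `∂_a G(u, v) = G(Γ(a, u), v) + G(u, Γ(a, v))`. -/
theorem fderiv_form_eq_christoffel (hG : DifferentiableAt ℝ G y)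
    (hs : ∀ᶠ z in 𝓝 y, ∀ u v, G z u v = G z v u) (hinv : (G y).IsInvertible) (a u v : Euc n) :
    fderiv ℝ G y a u v = G y (christoffel G y a u) v + G y u (christoffel G y a v) := by
  rw [hs.self_of_nhds u, form_christoffel hinv, form_christoffel hinv,
    fderiv_form_symm hG hs a v u, fderiv_form_symm hG hs u a v, fderiv_form_symm hG hs v a u]
  ring

/-- The gradient of `F` with respect to the metric `G`. -/
def flatGrad (G : Euc n → Euc n →L[ℝ] Euc n →L[ℝ] ℝ) (F : Euc n → ℝ) (y : Euc n) : Euc n :=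
  (G y).inverse (fderiv ℝ F y)

theorem form_flatGrad (hinv : (G y).IsInvertible) (v : Euc n) :
    G y (flatGrad G F y) v = fderiv ℝ F y v := by
  simp [flatGrad, hinv.self_apply_inverse]

/-- The difference of the Levi-Civita connections of `e^{2F} G` and `G` is the tensor
`dF(u) v + dF(v) u - G(u, v) ∇F`. -/
theorem christoffel_conformal (hG : DifferentiableAt ℝ G y) (hF : DifferentiableAt ℝ F y)
    (hinv : (G y).IsInvertible) (u v : Euc n) :
    christoffel (fun z => Real.exp (2 * F z) • G z) y u v
      = christoffel G y u v + fderiv ℝ F y u • v + fderiv ℝ F y v • u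
        - G y u v • flatGrad G F y := by
  have hd : HasFDerivAt (fun z => Real.exp (2 * F z) • G z)
      (Real.exp (2 * F y) • fderiv ℝ G y
        + (Real.exp (2 * F y) • (2 : ℝ) • fderiv ℝ F y).smulRight (G y)) y :=
    ((hF.hasFDerivAt.const_mul (2 : ℝ)).exp).fun_smul hG.hasFDerivAt
  unfold christoffel flatGrad
  rw [hd.fderiv, inverse_smul_of_ne_zero hinv (Real.exp_ne_zero _)]
  apply hinv.injective
  simp only [map_add, map_sub, map_smul, _root_.smul_apply, hinv.self_apply_inverse]
  ext w
  simp
  field_simp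
  ring

theorem contDiffAt_inverse_of_isInvertible {m : WithTop ℕ∞} (hG : ContDiffAt ℝ m G y)
    (hinv : (G y).IsInvertible) : ContDiffAt ℝ m (fun z => (G z).inverse) y := by
  obtain ⟨e, he⟩ := hinv
  have h := contDiffAt_map_inverse (𝕜 := ℝ) (n := m) e
  rw [he] at h
  exact h.comp y hG

theorem differentiableAt_flatGrad (hG : ContDiffAt ℝ 1 G y) (hF : ContDiffAt ℝ 2 F y)
    (hinv : (G y).IsInvertible) : DifferentiableAt ℝ (flatGrad G F) y :=
  ((contDiffAt_inverse_of_isInvertible hG hinv).differentiableAt one_ne_zero).clm_apply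
    ((hF.fderiv_right (m := 1) (by norm_num)).differentiableAt one_ne_zero)

theorem differentiableAt_christoffel (hG : ContDiffAt ℝ 2 G y) (hinv : (G y).IsInvertible)
    (u v : Euc n) : DifferentiableAt ℝ (fun z => christoffel G z u v) y := by
  have h1 := (contDiffAt_inverse_of_isInvertible hG hinv).differentiableAt two_ne_zero
  have h2 := (hG.fderiv_right (m := 1) (by norm_num)).differentiableAt one_ne_zero
  unfold christoffel
  refine h1.clm_apply (DifferentiableAt.fun_const_smul ?_ _)
  refine ((h2.clm_apply (differentiableAt_const _)).clm_apply (differentiableAt_const _)).add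
    ((h2.clm_apply (differentiableAt_const _)).clm_apply (differentiableAt_const _)) |>.sub ?_
  have h3 : DifferentiableAt ℝ (fun z => (fderiv ℝ G z).flip) y :=
    (ContinuousLinearMap.flipₗᵢ ℝ (Euc n) (Euc n) (Euc n →L[ℝ] ℝ)).differentiableAt.comp y h2
  exact (ContinuousLinearMap.flipₗᵢ ℝ (Euc n) (Euc n) ℝ).differentiableAt.comp y
    (h3.clm_apply (differentiableAt_const u)) |>.clm_apply (differentiableAt_const v)

/-- For `a` with constant coordinates, `∂_b (dF(a)) = Hess F(b, a) + dF(Γ(b, a))`. The Hessian is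
written as `G(∇_b ∇F, a)`; the identity is the derivative of `dF(a) = G(∇F, a)`. -/
theorem fderiv_fderiv_eq_covDeriv_flatGrad (hG : ContDiffAt ℝ 2 G y) (hF : ContDiffAt ℝ 2 F y)
    (hs : ∀ᶠ z in 𝓝 y, ∀ u v, G z u v = G z v u) (hinv : ∀ᶠ z in 𝓝 y, (G z).IsInvertible)
    (a b : Euc n) :
    fderiv ℝ (fun z => fderiv ℝ F z a) y b
      = G y (fderiv ℝ (flatGrad G F) y b + christoffel G y b (flatGrad G F y)) a
        + fderiv ℝ F y (christoffel G y b a) := by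
  have hG1 := hG.differentiableAt two_ne_zero
  have hN := differentiableAt_flatGrad (hG.of_le one_le_two) hF hinv.self_of_nhds
  have h1 : (fun z => fderiv ℝ F z a) =ᶠ[𝓝 y] fun z => G z (flatGrad G F z) a :=
    hinv.mono fun z hz => (form_flatGrad hz a).symm
  rw [h1.fderiv_eq, ((hG1.hasFDerivAt.clm_apply hN.hasFDerivAt).clm_apply
    (hasFDerivAt_const a y)).fderiv]
  simp [fderiv_form_eq_christoffel hG1 hs hinv.self_of_nhds,
    ← form_flatGrad (F := F) hinv.self_of_nhds]
  ring

/-- The curvature on fields with constant coordinates, whose bracket vanishes. -/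
theorem flatCurvature_const (G : Euc n → Euc n →L[ℝ] Euc n →L[ℝ] ℝ) (y a b c : Euc n) :
    flatCurvature G (fun _ => a) (fun _ => b) (fun _ => c) y
      = fderiv ℝ (fun z => christoffel G z a c) y b + christoffel G y b (christoffel G y a c)
        - (fderiv ℝ (fun z => christoffel G z b c) y a
            + christoffel G y a (christoffel G y b c)) := by
  have h0 : christoffel G y 0 c = 0 := by
    simpa using christoffel_smul_left G y 0 0 c
  have h1 : ∀ a c : Euc n, flatCovDeriv G (fun _ => a) (fun _ => c)
      = fun z => christoffel G z a c := by
    intro a c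
    funext z
    simp [flatCovDeriv]
  simp only [flatCurvature, Pi.add_apply, Pi.sub_apply, h1]
  simp [flatCovDeriv, VectorField.lieBracket, h0]

end

/-! ### Conformal change of the curvature -/

section
open Filter Topology

variable {n : ℕ} {G : Euc n → Euc n →L[ℝ] Euc n →L[ℝ] ℝ} {F : Euc n → ℝ} {y : Euc n}

theorem fderiv_christoffel_conformal (hG : ContDiffAt ℝ 2 G y) (hF : ContDiffAt ℝ 2 F y)
    (hinv : ∀ᶠ z in 𝓝 y, (G z).IsInvertible) (a b e : Euc n) :
    fderiv ℝ (fun z => christoffel (fun z => Real.exp (2 * F z) • G z) z a b) y e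
      = fderiv ℝ (fun z => christoffel G z a b) y e
        + fderiv ℝ (fun z => fderiv ℝ F z a) y e • b
        + fderiv ℝ (fun z => fderiv ℝ F z b) y e • a
        - (G y a b • fderiv ℝ (flatGrad G F) y e + fderiv ℝ G y e a b • flatGrad G F y) := by
  have hGd : ∀ᶠ z in 𝓝 y, DifferentiableAt ℝ G z :=
    (hG.eventually (by simp)).mono fun z hz => hz.differentiableAt two_ne_zero
  have hFd : ∀ᶠ z in 𝓝 y, DifferentiableAt ℝ F z :=
    (hF.eventually (by simp)).mono fun z hz => hz.differentiableAt two_ne_zero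
  have heq : (fun z => christoffel (fun z => Real.exp (2 * F z) • G z) z a b)
      =ᶠ[𝓝 y] fun z => christoffel G z a b + fderiv ℝ F z a • b + fderiv ℝ F z b • a
        - G z a b • flatGrad G F z := by
    filter_upwards [hGd, hFd, hinv] with z h1 h2 h3
    exact christoffel_conformal h1 h2 h3 a b
  have hΓ := (differentiableAt_christoffel hG hinv.self_of_nhds a b).hasFDerivAt
  have hN := (differentiableAt_flatGrad (hG.of_le one_le_two) hF hinv.self_of_nhds).hasFDerivAt
  have hF2 := (hF.fderiv_right (m := 1) (by norm_num)).differentiableAt one_ne_zero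
  have hd : ∀ c : Euc n, HasFDerivAt (fun z => fderiv ℝ F z c)
      (fderiv ℝ (fun z => fderiv ℝ F z c) y) y := fun c =>
    (hF2.clm_apply (differentiableAt_const c)).hasFDerivAt
  have hGab : HasFDerivAt (fun z => G z a b) _ y :=
    ((hG.differentiableAt two_ne_zero).hasFDerivAt.clm_apply (hasFDerivAt_const a y)).clm_apply
      (hasFDerivAt_const b y)
  rw [heq.fderiv_eq, (((hΓ.fun_add ((hd a).smul_const b)).fun_add ((hd b).smul_const a)).fun_sub
    (hGab.fun_smul hN)).fderiv]
  simp

/-- The conformal change of the curvature. Only arguments `u, w` orthogonal to `v` are considered: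
all terms of the general formula with a factor `G(u, v)` or `G(v, w)` drop out. -/
theorem form_flatCurvature_conformal (hG : ContDiffAt ℝ 2 G y) (hF : ContDiffAt ℝ 2 F y)
    (hs : ∀ᶠ z in 𝓝 y, ∀ u v, G z u v = G z v u) (hinv : ∀ᶠ z in 𝓝 y, (G z).IsInvertible)
    {v u w : Euc n} (hu : G y v u = 0) (hw : G y v w = 0) :
    G y (flatCurvature (fun z => Real.exp (2 * F z) • G z)
        (fun _ => v) (fun _ => u) (fun _ => v) y) w
      = G y (flatCurvature G (fun _ => v) (fun _ => u) (fun _ => v) y) w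
        - G y (fderiv ℝ (flatGrad G F) y v + christoffel G y v (flatGrad G F y)) v * G y u w
        - G y (fderiv ℝ (flatGrad G F) y u + christoffel G y u (flatGrad G F y)) w * G y v v
        + fderiv ℝ F y v ^ 2 * G y u w
        + fderiv ℝ F y u * fderiv ℝ F y w * G y v v
        - G y (flatGrad G F y) (flatGrad G F y) * G y v v * G y u w := by
  have hG1 := hG.differentiableAt two_ne_zero
  have hi := hinv.self_of_nhds
  have hs0 := hs.self_of_nhds
  have hu' : G y u v = 0 := by rw [hs0, hu]
  have hNv : ∀ a, G y a (flatGrad G F y) = fderiv ℝ F y a := fun a => by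
    rw [hs0, form_flatGrad hi]
  simp only [flatCurvature_const, fderiv_christoffel_conformal hG hF hinv,
    christoffel_conformal hG1 (hF.differentiableAt two_ne_zero) hi,
    fderiv_fderiv_eq_covDeriv_flatGrad hG hF hs hinv,
    fderiv_form_eq_christoffel hG1 hs hi, christoffel_add_right, christoffel_sub_right,
    christoffel_smul_right, map_add, map_sub, map_smul, _root_.add_apply, _root_.sub_apply,
    _root_.smul_apply, smul_eq_mul, hu, hw, hu', form_flatGrad hi, hNv, hs0 _ (christoffel G y _ _),
    christoffel_symm hG1 hs u v]
  ring

end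

/-! ### The metric in a chart -/

section
open Filter Topology Bundle

variable {n : ℕ}
  {M : Type*} [TopologicalSpace M] [ChartedSpace (Euc n) M] [IsManifold (𝓡 n) ∞ M]

theorem form_symm (g : Metric n M) (x : M) (u v : Euc n) : g.form x u v = g.form x v u :=
  g.symm x u v

theorem form_pos (g : Metric n M) (x : M) (v : Euc n) (hv : v ≠ 0) : 0 < g.form x v v :=
  g.pos x v hv

theorem form_conformal (g : Metric n M) (f : M → ℝ) (hf : ContMDiff (𝓡 n) 𝓘(ℝ, ℝ) ∞ f) (x : M) :
    (g.conformal f hf).form x = Real.exp (2 * f x) • g.form x := rfl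

/-- The differential at `y` of the inverse of the chart of `M` at `x`. Tangent spaces are by
definition the model space, so that it can be typed as an endomorphism of the latter; algebra is
done there, since the fibres of the tangent bundle carry no norm. -/
def chartSymmDeriv (n : ℕ) {M : Type*} [TopologicalSpace M] [ChartedSpace (Euc n) M] (x : M)
    (y : Euc n) : Euc n →L[ℝ] Euc n :=
  mfderiv 𝓘(ℝ, Euc n) (𝓡 n) (extChartAt (𝓡 n) x).symm y

/-- The differential at `z` of the chart of `M` at `x`. -/
def chartDeriv (n : ℕ) {M : Type*} [TopologicalSpace M] [ChartedSpace (Euc n) M] (x z : M) :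
    Euc n →L[ℝ] Euc n :=
  mvfderiv (𝓡 n) (extChartAt (𝓡 n) x) z

theorem mfderivWithin_extChartAt_symm_eq {n : ℕ} {M : Type*} [TopologicalSpace M]
    [ChartedSpace (Euc n) M] (x : M) (y : Euc n) :
    mfderivWithin 𝓘(ℝ, Euc n) (𝓡 n) (extChartAt (𝓡 n) x).symm (Set.range (𝓡 n)) y
      = chartSymmDeriv n x y := by
  rw [modelWithCornersSelf_coe, Set.range_id, mfderivWithin_univ]
  rfl

theorem chartDeriv_chartSymmDeriv (x : M) {y : Euc n} (hy : y ∈ (extChartAt (𝓡 n) x).target)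
    (v : Euc n) :
    chartDeriv n x ((extChartAt (𝓡 n) x).symm y) (chartSymmDeriv n x y v) = v := by
  have := mfderiv_extChartAt_comp_mfderivWithin_extChartAt_symm (I := 𝓡 n) hy
  rw [mfderivWithin_extChartAt_symm_eq] at this
  exact congrArg (fun L => L v) this

theorem chartSymmDeriv_chartDeriv (x : M) {z : M} (hz : z ∈ (extChartAt (𝓡 n) x).source)
    (v : Euc n) :
    chartSymmDeriv n x (extChartAt (𝓡 n) x z) (chartDeriv n x z v) = v := by
  have := mfderivWithin_extChartAt_symm_comp_mfderiv_extChartAt' (I := 𝓡 n) hz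
  rw [mfderivWithin_extChartAt_symm_eq] at this
  exact congrArg (fun L => L v) this

theorem chartSymmDeriv_self (x : M) (v : Euc n) :
    chartSymmDeriv n x (extChartAt (𝓡 n) x x) v = v := by
  have := mfderivWithin_range_extChartAt_symm (I := 𝓡 n) (x := x)
  rw [mfderivWithin_extChartAt_symm_eq] at this
  exact congrArg (fun L => L v) this

theorem chartDeriv_self (x : M) (v : Euc n) : chartDeriv n x x v = v := by
  have := mfderiv_extChartAt_self (I := 𝓡 n) (x := x)
  exact congrArg (fun L => L v) this

/-- The differential of the chart at `x` is the trivialization of the tangent bundle at `x`. -/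
theorem trivializationAt_snd (x : M) {z : M} (hz : z ∈ (extChartAt (𝓡 n) x).source)
    (v : TangentSpace (𝓡 n) z) :
    (trivializationAt (Euc n) (TangentSpace (𝓡 n)) x ⟨z, v⟩).2 = chartDeriv n x z v := by
  rw [extChartAt_source] at hz
  have := TangentBundle.continuousLinearMapAt_trivializationAt (I := 𝓡 n) hz
  rw [← Trivialization.continuousLinearMapAt_apply_of_mem ℝ _ (by exact hz), this]
  rfl

theorem inChart_apply (g : Metric n M) (x : M) (y u v : Euc n) :
    g.inChart x y u v = g.form ((extChartAt (𝓡 n) x).symm y)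
      (chartSymmDeriv n x y u) (chartSymmDeriv n x y v) := rfl

theorem inChart_conformal (g : Metric n M) (f : M → ℝ) (hf : ContMDiff (𝓡 n) 𝓘(ℝ, ℝ) ∞ f) (x : M) :
    (g.conformal f hf).inChart x
      = fun y => Real.exp (2 * f ((extChartAt (𝓡 n) x).symm y)) • g.inChart x y := by
  funext y
  ext u v
  simp only [inChart_apply, form_conformal, _root_.smul_apply]

theorem inChart_symm (g : Metric n M) (x : M) (y u v : Euc n) :
    g.inChart x y u v = g.inChart x y v u := by
  rw [inChart_apply, inChart_apply, form_symm]

theorem inChart_self (g : Metric n M) (x : M) :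
    g.inChart x (extChartAt (𝓡 n) x x) = g.form x := by
  ext u v
  rw [inChart_apply, chartSymmDeriv_self, chartSymmDeriv_self, extChartAt_to_inv]

theorem inChart_isInvertible (g : Metric n M) (x : M) {y : Euc n}
    (hy : y ∈ (extChartAt (𝓡 n) x).target) : (g.inChart x y).IsInvertible := by
  apply isInvertible_of_pos
  intro v hv
  rw [inChart_apply]
  apply form_pos
  intro h0
  have := chartDeriv_chartSymmDeriv x hy v
  rw [h0, map_zero] at this
  exact hv this.symm

theorem eventually_inChart_isInvertible (g : Metric n M) (x : M) :
    ∀ᶠ y in 𝓝 (extChartAt (𝓡 n) x x), (g.inChart x y).IsInvertible := by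
  filter_upwards [extChartAt_target_mem_nhds (I := 𝓡 n) x] with y hy
  exact inChart_isInvertible g x hy

theorem form_isInvertible (g : Metric n M) (x : M) : (g.form x).IsInvertible :=
  isInvertible_of_pos (form_pos g x)

theorem contMDiffAt_extChartAt_symm_self (x : M) :
    ContMDiffAt 𝓘(ℝ, Euc n) (𝓡 n) ∞ (extChartAt (𝓡 n) x).symm (extChartAt (𝓡 n) x x) :=
  (contMDiffOn_extChartAt_symm x).contMDiffAt (extChartAt_target_mem_nhds x)

theorem contDiffAt_comp_extChartAt_symm {f : M → ℝ} (hf : ContMDiff (𝓡 n) 𝓘(ℝ, ℝ) ∞ f) (x : M) :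
    ContDiffAt ℝ ∞ (f ∘ (extChartAt (𝓡 n) x).symm) (extChartAt (𝓡 n) x x) := by
  rw [← contMDiffAt_iff_contDiffAt]
  exact hf.contMDiffAt.comp _ (contMDiffAt_extChartAt_symm_self x)

theorem bilin_eq_sum (b : Euc n →L[ℝ] Euc n →L[ℝ] ℝ) :
    b = ∑ i, ∑ j, b (EuclideanSpace.single i 1) (EuclideanSpace.single j 1) •
      (EuclideanSpace.proj i : Euc n →L[ℝ] ℝ).smulRight
        (EuclideanSpace.proj j : Euc n →L[ℝ] ℝ) := by
  ext u v
  conv_lhs => rw [show u = ∑ i, u i • EuclideanSpace.single i (1 : ℝ) by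
      ext l; simp [Finset.sum_apply, Pi.single_apply],
    show v = ∑ i, v i • EuclideanSpace.single i (1 : ℝ) by
      ext l; simp [Finset.sum_apply, Pi.single_apply]]
  simp only [map_sum, map_smul, _root_.sum_apply, _root_.smul_apply, smul_eq_mul, Finset.mul_sum,
    ContinuousLinearMap.smulRight_apply, EuclideanSpace.coe_proj]
  refine Finset.sum_comm.trans (Finset.sum_congr rfl fun i _ => Finset.sum_congr rfl fun j _ => ?_)
  ring

/-- The coefficients of the metric in a chart are smooth. -/
theorem contDiffAt_inChart (g : Metric n M) (x : M) :
    ContDiffAt ℝ ∞ (g.inChart x) (extChartAt (𝓡 n) x x) := by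
  have hsymm := contMDiffAt_extChartAt_symm_self (n := n) x
  have hsec : ∀ w : Euc n, ContMDiffAt 𝓘(ℝ, Euc n) (𝓡 n).tangent ∞
      (fun y => (⟨(extChartAt (𝓡 n) x).symm y, chartSymmDeriv n x y w⟩ : TangentBundle (𝓡 n) M))
      (extChartAt (𝓡 n) x x) := by
    intro w
    rw [Trivialization.contMDiffAt_iff (e := trivializationAt (Euc n) (TangentSpace (𝓡 n)) x)]
    · refine ⟨hsymm, contMDiffAt_const (c := w) |>.congr_of_eventuallyEq ?_⟩
      filter_upwards [extChartAt_target_mem_nhds (I := 𝓡 n) x] with y hy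
      exact (trivializationAt_snd x ((extChartAt (𝓡 n) x).map_target hy) _).trans
        (chartDeriv_chartSymmDeriv x hy w)
    · simp
  have key : ∀ u v : Euc n,
      ContDiffAt ℝ ∞ (fun y => g.inChart x y u v) (extChartAt (𝓡 n) x x) := by
    intro u v
    rw [← contMDiffAt_iff_contDiffAt]
    have hg := g.contMDiff.contMDiffAt.comp (extChartAt (𝓡 n) x x) hsymm
    have := ContMDiffAt.clm_bundle_apply₂ (F₁ := Euc n) (F₂ := Euc n) (F₃ := ℝ)
      (E₃ := Bundle.Trivial M ℝ) hg (hsec u) (hsec v)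
    exact (contMDiffAt_totalSpace.1 this).2
  rw [funext fun y => bilin_eq_sum (g.inChart x y)]
  exact ContDiffAt.sum fun i _ => ContDiffAt.sum fun j _ => (key _ _).smul contDiffAt_const

end

/-! ### Gradient, Hessian and curvature in a chart -/

section
open Filter Topology Bundle

variable {n : ℕ}
  {M : Type*} [TopologicalSpace M] [ChartedSpace (Euc n) M] [IsManifold (𝓡 n) ∞ M]

/-- The differential of `f` at `x`, as a functional on the coordinate space `T_x M = ℝⁿ`. -/
def funDeriv (n : ℕ) {M : Type*} [TopologicalSpace M] [ChartedSpace (Euc n) M] (f : M → ℝ) (x : M) :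
    Euc n →L[ℝ] ℝ :=
  mvfderiv (𝓡 n) f x

/-- The local representative of `f` in the chart at `x`. -/
def funInChart (n : ℕ) {M : Type*} [TopologicalSpace M] [ChartedSpace (Euc n) M] (f : M → ℝ)
    (x : M) : Euc n → ℝ :=
  fun y => f ((extChartAt (𝓡 n) x).symm y)

theorem fderiv_funInChart {f : M → ℝ} (hf : ContMDiff (𝓡 n) 𝓘(ℝ, ℝ) ∞ f) (x : M) {y : Euc n}
    (hy : y ∈ (extChartAt (𝓡 n) x).target) (v : Euc n) :
    fderiv ℝ (funInChart n f x) y v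
      = funDeriv n f ((extChartAt (𝓡 n) x).symm y) (chartSymmDeriv n x y v) := by
  have h1 : MDifferentiableAt 𝓘(ℝ, Euc n) (𝓡 n) (extChartAt (𝓡 n) x).symm y := by
    have := mdifferentiableWithinAt_extChartAt_symm (I := 𝓡 n) hy
    rwa [modelWithCornersSelf_coe, Set.range_id, mdifferentiableWithinAt_univ] at this
  have h2 := mfderiv_comp y
    (hf.mdifferentiableAt (by simp) (x := (extChartAt (𝓡 n) x).symm y)) h1
  rw [mfderiv_eq_fderiv] at h2
  exact congrArg (fun L => L v) h2

theorem fderiv_funInChart_self {f : M → ℝ} (hf : ContMDiff (𝓡 n) 𝓘(ℝ, ℝ) ∞ f) (x : M) :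
    fderiv ℝ (funInChart n f x) (extChartAt (𝓡 n) x x) = funDeriv n f x := by
  ext v
  rw [fderiv_funInChart hf x (mem_extChartAt_target x), chartSymmDeriv_self, extChartAt_to_inv]

/-- The gradient of `f`, as a vector of the coordinate space. -/
def Metric.gradVec (g : Metric n M) (f : M → ℝ) (x : M) : Euc n := g.grad f x

/-- The derivative `∇_v ∇f`, as a vector of the coordinate space. -/
def Metric.covGrad (g : Metric n M) (f : M → ℝ) (x : M) (v : Euc n) : Euc n :=
  g.covDeriv (g.grad f) x v

/-- The curvature `R(u, v) w`, on vectors of the coordinate space. -/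
def Metric.riemann (g : Metric n M) (x : M) (u v w : Euc n) : Euc n := g.curvature x u v w

theorem form_grad (g : Metric n M) (f : M → ℝ) (x : M) (v : Euc n) :
    g.form x (g.gradVec f x) v = funDeriv n f x v :=
  congrArg (fun L : Euc n →L[ℝ] ℝ => L v)
    ((form_isInvertible g x).self_apply_inverse (funDeriv n f x))

theorem flatGrad_inChart_self (g : Metric n M) {f : M → ℝ} (hf : ContMDiff (𝓡 n) 𝓘(ℝ, ℝ) ∞ f)
    (x : M) :
    flatGrad (g.inChart x) (funInChart n f x) (extChartAt (𝓡 n) x x) = g.gradVec f x := by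
  unfold flatGrad
  rw [fderiv_funInChart_self hf, inChart_self]
  rfl

/-- The gradient of `f` is represented in a chart by the gradient of the local representative, at
every point of the chart domain. -/
theorem chartDeriv_grad (g : Metric n M) {f : M → ℝ} (hf : ContMDiff (𝓡 n) 𝓘(ℝ, ℝ) ∞ f)
    (x : M) {z : M} (hz : z ∈ (extChartAt (𝓡 n) x).source) :
    chartDeriv n x z (g.gradVec f z)
      = flatGrad (g.inChart x) (funInChart n f x) (extChartAt (𝓡 n) x z) := by
  have ht := (extChartAt (𝓡 n) x).map_source hz
  have hi := inChart_isInvertible g x ht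
  apply hi.injective
  ext v
  rw [form_flatGrad hi, fderiv_funInChart hf x ht, inChart_apply,
    chartSymmDeriv_chartDeriv x hz, (extChartAt (𝓡 n) x).left_inv hz, form_grad]

/-- The Christoffel symbols of `g` at the centre of the chart at `x`. -/
def Metric.christoffelAt (g : Metric n M) (x : M) (u v : Euc n) : Euc n :=
  christoffel (g.inChart x) (extChartAt (𝓡 n) x x) u v

/-- `∇_v ∇f` in terms of the local representative of `f` in the chart at `x`. -/
theorem covDeriv_grad (g : Metric n M) {f : M → ℝ} (hf : ContMDiff (𝓡 n) 𝓘(ℝ, ℝ) ∞ f)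
    (x : M) (v : Euc n) :
    g.covGrad f x v
      = fderiv ℝ (flatGrad (g.inChart x) (funInChart n f x)) (extChartAt (𝓡 n) x x) v
        + g.christoffelAt x v
            (flatGrad (g.inChart x) (funInChart n f x) (extChartAt (𝓡 n) x x)) := by
  have h0 : g.covGrad f x v
      = mvfderiv (𝓡 n) (fun z => chartDeriv n x z (g.gradVec f z)) x v
        + g.christoffelAt x (mfderiv (𝓡 n) (𝓡 n) (id : M → M) x v) (g.gradVec f x) := rfl
  have hdiff : DifferentiableAt ℝ (flatGrad (g.inChart x) (funInChart n f x))
      (extChartAt (𝓡 n) x x) :=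
    differentiableAt_flatGrad ((contDiffAt_inChart g x).of_le ENat.LEInfty.out)
      ((contDiffAt_comp_extChartAt_symm hf x).of_le ENat.LEInfty.out)
      (eventually_inChart_isInvertible g x).self_of_nhds
  have heq : (fun z => chartDeriv n x z (g.gradVec f z))
      =ᶠ[𝓝 x] flatGrad (g.inChart x) (funInChart n f x) ∘ extChartAt (𝓡 n) x := by
    filter_upwards [extChartAt_source_mem_nhds (I := 𝓡 n) x] with z hz
    exact chartDeriv_grad g hf x hz
  have h1 : mvfderiv (𝓡 n) (fun z => chartDeriv n x z (g.gradVec f z)) x v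
      = fderiv ℝ (flatGrad (g.inChart x) (funInChart n f x)) (extChartAt (𝓡 n) x x) v := by
    have h2 := mfderiv_comp x hdiff.mdifferentiableAt
      (mdifferentiableAt_extChartAt (I := 𝓡 n) (mem_chart_source (Euc n) x))
    rw [← heq.mfderiv_eq, mfderiv_eq_fderiv] at h2
    have h3 := congrArg (fun L => L v) h2
    refine h3.trans ?_
    exact congrArg _ (chartDeriv_self x v)
  rw [h0, h1, mfderiv_id, flatGrad_inChart_self g hf]
  rfl

/-- The global form of `christoffel_conformal`. -/
theorem christoffelAt_conformal (g : Metric n M) {f : M → ℝ} (hf : ContMDiff (𝓡 n) 𝓘(ℝ, ℝ) ∞ f)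
    (x : M) (u v : Euc n) :
    (g.conformal f hf).christoffelAt x u v
      = g.christoffelAt x u v + funDeriv n f x u • v + funDeriv n f x v • u
        - g.form x u v • g.gradVec f x := by
  unfold Metric.christoffelAt
  rw [inChart_conformal]
  refine (christoffel_conformal (F := funInChart n f x)
    ((contDiffAt_inChart g x).differentiableAt (by simp))
    ((contDiffAt_comp_extChartAt_symm hf x).differentiableAt (by simp))
    (eventually_inChart_isInvertible g x).self_of_nhds u v).trans ?_
  rw [fderiv_funInChart_self hf, inChart_self, flatGrad_inChart_self g hf]

theorem riemann_eq (g : Metric n M) (x : M) (a b c : Euc n) :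
    g.riemann x a b c
      = flatCurvature (g.inChart x) (fun _ => a) (fun _ => b) (fun _ => c)
          (extChartAt (𝓡 n) x x) := rfl

theorem riemann_smul (g : Metric n M) (x : M) (c : ℝ) (v u : Euc n) :
    g.riemann x (c • v) u (c • v) = c ^ 2 • g.riemann x v u v := by
  have h (z a b : Euc n) (d : ℝ) := christoffel_smul_left (g.inChart x) z d a b
  have h' (z a b : Euc n) (d : ℝ) := christoffel_smul_right (g.inChart x) z d a b
  have hd (a b : Euc n) (d : ℝ) := fderiv_fun_const_smul (𝕜 := ℝ)
    (differentiableAt_christoffel ((contDiffAt_inChart g x).of_le ENat.LEInfty.out)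
      (eventually_inChart_isInvertible g x).self_of_nhds a b) d
  simp only [riemann_eq, flatCurvature_const, h, h', smul_smul, hd, map_smul, _root_.smul_apply,
    smul_sub, smul_add, pow_two]

/-- The global form of `form_flatCurvature_conformal`. -/
theorem form_curvature_conformal (g : Metric n M) {f : M → ℝ}
    (hf : ContMDiff (𝓡 n) 𝓘(ℝ, ℝ) ∞ f) (x : M) {v u w : Euc n} (hu : g.form x v u = 0)
    (hw : g.form x v w = 0) :
    g.form x ((g.conformal f hf).riemann x v u v) w
      = g.form x (g.riemann x v u v) w
        - g.form x (g.covGrad f x v) v * g.form x u w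
        - g.form x (g.covGrad f x u) w * g.form x v v
        + funDeriv n f x v ^ 2 * g.form x u w
        + funDeriv n f x u * funDeriv n f x w * g.form x v v
        - g.form x (g.gradVec f x) (g.gradVec f x) * g.form x v v * g.form x u w := by
  have h0 := inChart_self g x
  have := form_flatCurvature_conformal (G := g.inChart x) (F := funInChart n f x) (v := v)
    (u := u) (w := w) ((contDiffAt_inChart g x).of_le ENat.LEInfty.out)
    ((contDiffAt_comp_extChartAt_symm hf x).of_le ENat.LEInfty.out)
    (Eventually.of_forall fun z => inChart_symm g x z)
    (eventually_inChart_isInvertible g x) (by rw [h0, hu]) (by rw [h0, hw])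
  rw [h0, fderiv_funInChart_self hf] at this
  rw [covDeriv_grad g hf, covDeriv_grad g hf]
  rw [← flatGrad_inChart_self g hf]
  refine Eq.trans ?_ this
  rw [riemann_eq, inChart_conformal]
  rfl

end

/-! ### Projections, covariant derivatives and the second fundamental form along the submanifold -/

section
open Filter Topology Bundle

variable {n k : ℕ}
  {M : Type*} [TopologicalSpace M] [ChartedSpace (Euc n) M] [IsManifold (𝓡 n) ∞ M]
  {S : Type*} [TopologicalSpace S] [ChartedSpace (Euc k) S]

theorem induced_apply (g : Metric n M) (ι : S → M) (p : S) (u v : Euc k) :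
    g.induced k ι p u v = g.form (ι p) (diffl k ι p u) (diffl k ι p v) := rfl

theorem induced_symm (g : Metric n M) (ι : S → M) (p : S) (u v : Euc k) :
    g.induced k ι p u v = g.induced k ι p v u := form_symm g _ _ _

theorem induced_isInvertible (g : Metric n M) {ι : S → M} {p : S}
    (hinj : Function.Injective (diffl (n := n) k ι p)) : (g.induced k ι p).IsInvertible := by
  apply isInvertible_of_pos
  intro v hv
  exact form_pos g _ _ fun h0 => hv (hinj (h0.trans (map_zero _).symm))

theorem induced_conformal (g : Metric n M) {f : M → ℝ} (hf : ContMDiff (𝓡 n) 𝓘(ℝ, ℝ) ∞ f)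
    (ι : S → M) (p : S) :
    (g.conformal f hf).induced k ι p = Real.exp (2 * f (ι p)) • g.induced k ι p := rfl

/-- The orthogonal projection of `T_p M` onto the normal space of `Σ`, as a linear map. -/
def Metric.normalProj (g : Metric n M) (ι : S → M) (p : S) : Euc n →ₗ[ℝ] Euc n where
  toFun X :=
    X - diffl k ι p ((g.induced k ι p).inverse ((g.form (ι p) X).comp (diffl k ι p)))
  map_add' X Y := by
    simp only [map_add, ContinuousLinearMap.add_comp]
    abel
  map_smul' c X := by
    simp only [map_smul, ContinuousLinearMap.smul_comp, smul_sub, RingHom.id_apply]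

theorem normalProj_apply (g : Metric n M) (ι : S → M) (p : S) (X : Euc n) :
    g.normalProj (k := k) ι p X
      = X - diffl k ι p ((g.induced k ι p).inverse ((g.form (ι p) X).comp (diffl k ι p))) := rfl

theorem normalProj_diffl (g : Metric n M) {ι : S → M} {p : S}
    (hinj : Function.Injective (diffl (n := n) k ι p)) (u : Euc k) :
    g.normalProj (k := k) ι p (diffl k ι p u) = 0 := by
  have h : (g.form (ι p) (diffl k ι p u)).comp (diffl k ι p) = g.induced k ι p u := rfl
  rw [normalProj_apply, h, (induced_isInvertible g hinj).inverse_apply_self, sub_self]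

/-- Orthogonality, and hence the normal projection, is the same for conformal metrics. -/
theorem normalProj_conformal (g : Metric n M) {f : M → ℝ} (hf : ContMDiff (𝓡 n) 𝓘(ℝ, ℝ) ∞ f)
    {ι : S → M} {p : S} (hinj : Function.Injective (diffl (n := n) k ι p)) :
    (g.conformal f hf).normalProj (k := k) ι p = g.normalProj (k := k) ι p := by
  ext1 X
  rw [normalProj_apply, normalProj_apply, induced_conformal, form_conformal,
    inverse_smul_of_ne_zero (induced_isInvertible g hinj) (Real.exp_ne_zero _),
    _root_.smul_apply, _root_.smul_apply, ContinuousLinearMap.smul_comp, map_smul, map_smul,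
    map_smul, smul_smul, inv_mul_cancel₀ (Real.exp_ne_zero _), one_smul]

theorem form_normalProj (g : Metric n M) {ι : S → M} {p : S} {V : Euc n}
    (hV : ∀ u, g.form (ι p) V (diffl k ι p u) = 0) (X : Euc n) :
    g.form (ι p) (g.normalProj (k := k) ι p X) V = g.form (ι p) X V := by
  rw [normalProj_apply, map_sub, _root_.sub_apply, form_symm g _ (diffl k ι p _), hV, sub_zero]

/-- The derivative at `p` of the coordinates, in the chart of `M` at `ι p`, of a vector field `Y`
along `ι`. -/
def coordDeriv (k : ℕ) {n : ℕ} {M : Type*} [TopologicalSpace M] [ChartedSpace (Euc n) M]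
    {S : Type*} [TopologicalSpace S] [ChartedSpace (Euc k) S] (ι : S → M) (Y : S → Euc n) (p : S) :
    Euc k →L[ℝ] Euc n :=
  mvfderiv (𝓡 k) (fun q => chartDeriv n (ι p) (ι q) (Y q)) p

/-- The covariant derivative along `ι` of a vector field, as a linear map of the direction. -/
def Metric.covAlong (g : Metric n M) (ι : S → M) (Y : S → Euc n) (p : S) :
    Euc k →ₗ[ℝ] Euc n where
  toFun u := coordDeriv k ι Y p u + g.christoffelAt (ι p) (diffl k ι p u) (Y p)
  map_add' u v := by
    simp only [map_add, Metric.christoffelAt, christoffel_add_left]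
    abel
  map_smul' c u := by
    simp only [map_smul, Metric.christoffelAt, christoffel_smul_left, smul_add, RingHom.id_apply]

theorem covAlong_apply (g : Metric n M) (ι : S → M) (Y : S → Euc n) (p : S) (u : Euc k) :
    g.covAlong ι Y p u = coordDeriv k ι Y p u + g.christoffelAt (ι p) (diffl k ι p u) (Y p) := rfl

/-- A smooth vector field along `ι` has differentiable coordinates in the chart at `ι p`. -/
theorem mdifferentiableAt_chartDeriv {ι : S → M} {V : S → Euc n}
    (hV : ContMDiff (𝓡 k) (𝓡 n).tangent ∞ (fun q => (⟨ι q, V q⟩ : TangentBundle (𝓡 n) M)))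
    (p : S) :
    MDifferentiableAt (𝓡 k) 𝓘(ℝ, Euc n) (fun q => chartDeriv n (ι p) (ι q) (V q)) p := by
  have h := contMDiffAt_totalSpace.1 (hV.contMDiffAt (x := p))
  refine (h.2.congr_of_eventuallyEq ?_).mdifferentiableAt (by simp)
  have hc : ContinuousAt ι p := h.1.continuousAt
  filter_upwards [hc (extChartAt_source_mem_nhds (I := 𝓡 n) (ι p))] with q hq
  exact (trivializationAt_snd (ι p) hq (V q)).symm

theorem coordDeriv_exp_smul {f : M → ℝ} (hf : ContMDiff (𝓡 n) 𝓘(ℝ, ℝ) ∞ f)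
    {ι : S → M} (hι : ContMDiff (𝓡 k) (𝓡 n) ∞ ι) {V : S → Euc n}
    (hV : ContMDiff (𝓡 k) (𝓡 n).tangent ∞ (fun q => (⟨ι q, V q⟩ : TangentBundle (𝓡 n) M)))
    (p : S) (u : Euc k) :
    coordDeriv k ι (fun q => Real.exp (-f (ι q)) • V q) p u
      = Real.exp (-f (ι p)) •
        (coordDeriv k ι V p u - funDeriv n f (ι p) (diffl k ι p u) • V p) := by
  have h1 : HasMFDerivAt (𝓡 k) 𝓘(ℝ, ℝ) (f ∘ ι) p
      ((mfderiv (𝓡 n) 𝓘(ℝ, ℝ) f (ι p)).comp (mfderiv (𝓡 k) (𝓡 n) ι p)) :=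
    (hf.mdifferentiableAt (by simp)).hasMFDerivAt.comp p
      (hι.mdifferentiableAt (by simp)).hasMFDerivAt
  have h2 : HasFDerivAt (fun t : ℝ => Real.exp (-t))
      (Real.exp (-f (ι p)) • (-ContinuousLinearMap.id ℝ ℝ)) (f (ι p)) :=
    (hasFDerivAt_id (𝕜 := ℝ) (f (ι p))).neg.exp
  have h3 : HasMFDerivAt (𝓡 k) 𝓘(ℝ, ℝ) (fun q => Real.exp (-f (ι q))) p _ :=
    HasMFDerivAt.comp (g := fun t : ℝ => Real.exp (-t)) (f := f ∘ ι) p h2.hasMFDerivAt h1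
  have h4 := mvfderiv_fun_smul h3.mdifferentiableAt (mdifferentiableAt_chartDeriv hV p)
  have h5 : mvfderiv (𝓡 k) (fun q => Real.exp (-f (ι q))) p u
      = Real.exp (-f (ι p)) * -(funDeriv n f (ι p) (diffl k ι p u)) :=
    congrArg (fun L => L u) h3.mfderiv
  have h6 : coordDeriv k ι (fun q => Real.exp (-f (ι q)) • V q) p u
      = mvfderiv (𝓡 k) (fun q => Real.exp (-f (ι q)) • chartDeriv n (ι p) (ι q) (V q)) p u := by
    unfold coordDeriv
    simp only [map_smul]
    rfl
  rw [h6, h4]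
  change Real.exp (-f (ι p)) • coordDeriv k ι V p u
    + mvfderiv (𝓡 k) (fun q => Real.exp (-f (ι q))) p u • chartDeriv n (ι p) (ι p) (V p) = _
  rw [h5, chartDeriv_self, smul_sub, smul_smul, mul_neg, neg_smul, sub_eq_add_neg]

/-- `∇̃_u (e^{-f} V) = e^{-f} (∇_u V + df(V) u - g(u, V) ∇f)`: differentiating the factor `e^{-f}`
cancels the term `df(u) V` of the difference of the connections. For normal `V` the last term
vanishes and the second one is tangential. -/
theorem covAlong_conformal (g : Metric n M) {f : M → ℝ} (hf : ContMDiff (𝓡 n) 𝓘(ℝ, ℝ) ∞ f)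
    {ι : S → M} (hι : ContMDiff (𝓡 k) (𝓡 n) ∞ ι) {V : S → Euc n}
    (hV : ContMDiff (𝓡 k) (𝓡 n).tangent ∞ (fun q => (⟨ι q, V q⟩ : TangentBundle (𝓡 n) M)))
    (p : S) (u : Euc k) :
    (g.conformal f hf).covAlong ι (fun q => Real.exp (-f (ι q)) • V q) p u
      = Real.exp (-f (ι p)) • (g.covAlong ι V p u + funDeriv n f (ι p) (V p) • diffl k ι p u
        - g.form (ι p) (diffl k ι p u) (V p) • g.gradVec f (ι p)) := by
  rw [covAlong_apply, covAlong_apply, coordDeriv_exp_smul hf hι hV, christoffelAt_conformal]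
  simp only [Metric.christoffelAt, christoffel_smul_right, map_smul, smul_eq_mul]
  module

/-- The differential of `ι` in the charts at `p` and `ι p`. -/
def difflInCharts (k : ℕ) {n : ℕ} {M : Type*} [TopologicalSpace M] [ChartedSpace (Euc n) M]
    {S : Type*} [TopologicalSpace S] [ChartedSpace (Euc k) S] (ι : S → M) (p q : S) :
    Euc k →L[ℝ] Euc n :=
  (chartDeriv n (ι p) (ι q)).comp
    ((diffl k ι q).comp (chartSymmDeriv k p (extChartAt (𝓡 k) p q)))

theorem mdifferentiableAt_difflInCharts [IsManifold (𝓡 k) ∞ S] {ι : S → M}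
    (hι : ContMDiff (𝓡 k) (𝓡 n) ∞ ι) (p : S) :
    MDifferentiableAt (𝓡 k) 𝓘(ℝ, Euc k →L[ℝ] Euc n) (difflInCharts (n := n) k ι p) p := by
  have h := (hι.contMDiffAt (x := p)).mfderiv_const (m := 1) (by norm_cast)
  refine (h.mdifferentiableAt one_ne_zero).congr_of_eventuallyEq ?_
  filter_upwards [hι.continuous.continuousAt (extChartAt_source_mem_nhds (I := 𝓡 n) (ι p)),
    extChartAt_source_mem_nhds (I := 𝓡 k) p] with q h1 h2
  have h1' : ι q ∈ (extChartAt (𝓡 n) (ι p)).source := h1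
  rw [extChartAt_source] at h1' h2
  rw [inTangentCoordinates_eq_mfderiv_comp h2 h1']
  rw [id, id, mfderivWithin_extChartAt_symm_eq]
  rfl

/-- The section of `TΣ` used to extend a tangent vector `v` at `p` has constant coordinates in the
chart at `p`. -/
theorem extend_eq [IsManifold (𝓡 k) ∞ S] (p : S) (v : Euc k) {q : S}
    (hq : q ∈ (extChartAt (𝓡 k) p).source) :
    (FiberBundle.extend (Euc k) (show TangentSpace (𝓡 k) p from v) q : TangentSpace (𝓡 k) q)
      = chartSymmDeriv k p (extChartAt (𝓡 k) p q) v := by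
  have h1 := trivializationAt_snd p (mem_extChartAt_source p) v
  rw [chartDeriv_self] at h1
  rw [extChartAt_source] at hq
  have h2 := TangentBundle.symmL_trivializationAt (I := 𝓡 k) hq
  rw [mfderivWithin_extChartAt_symm_eq] at h2
  have h3 := congrArg (fun L => L v) h2
  refine Eq.trans ?_ h3
  unfold FiberBundle.extend
  rw [Trivialization.symmL_apply _ (by exact hq)]
  exact congrArg _ h1

/-- The coordinate derivative occurring in the second fundamental form is the second derivative of
`ι` in charts. In particular it is linear in the extended vector `v`. -/
theorem coordDeriv_extend [IsManifold (𝓡 k) ∞ S] {ι : S → M}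
    (hι : ContMDiff (𝓡 k) (𝓡 n) ∞ ι) (p : S) (u v : Euc k) :
    coordDeriv k ι (fun q => diffl k ι q
        (FiberBundle.extend (Euc k) (show TangentSpace (𝓡 k) p from v) q)) p u
      = (mvfderiv (𝓡 k) (difflInCharts k ι p) p u : Euc k →L[ℝ] Euc n) v := by
  have heq : (fun q => chartDeriv n (ι p) (ι q) (diffl k ι q
        (FiberBundle.extend (Euc k) (show TangentSpace (𝓡 k) p from v) q)))
      =ᶠ[𝓝 p] (ContinuousLinearMap.apply ℝ (Euc n) v) ∘ difflInCharts k ι p := by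
    filter_upwards [extChartAt_source_mem_nhds (I := 𝓡 k) p] with q hq
    exact congrArg (fun w => chartDeriv n (ι p) (ι q) (diffl k ι q w)) (extend_eq p v hq)
  have h2 := mfderiv_comp p
    (ContinuousLinearMap.apply ℝ (Euc n) v).differentiableAt.mdifferentiableAt
    (mdifferentiableAt_difflInCharts hι p)
  rw [← heq.mfderiv_eq, mfderiv_eq_fderiv, ContinuousLinearMap.fderiv] at h2
  exact congrArg (fun L => L u) h2

/-- The second fundamental form as a bilinear map: the normal part of the sum of the second
derivative of `ι` in charts and the Christoffel term. See `secondForm_eq` for the comparison with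
`Metric.secondForm`. -/
def Metric.secondFormBilin (g : Metric n M) (ι : S → M) (p : S) :
    Euc k →ₗ[ℝ] Euc k →ₗ[ℝ] Euc n :=
  LinearMap.mk₂ ℝ (fun u v => g.normalProj (k := k) ι p
      ((mvfderiv (𝓡 k) (difflInCharts k ι p) p u : Euc k →L[ℝ] Euc n) v
        + g.christoffelAt (ι p) (diffl k ι p u) (diffl k ι p v)))
    (by
      intro u u' v
      have h : mvfderiv (𝓡 k) (difflInCharts (n := n) k ι p) p (u + u')
        = mvfderiv (𝓡 k) (difflInCharts k ι p) p u + mvfderiv (𝓡 k) (difflInCharts k ι p) p u' :=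
          map_add _ u u'
      simp only [h, map_add, Metric.christoffelAt, christoffel_add_left, _root_.add_apply]
      abel)
    (by
      intro c u v
      have h : mvfderiv (𝓡 k) (difflInCharts (n := n) k ι p) p (c • u)
        = c • mvfderiv (𝓡 k) (difflInCharts k ι p) p u := map_smul _ c u
      simp only [h, map_smul, Metric.christoffelAt, christoffel_smul_left, _root_.smul_apply,
        map_add, smul_add])
    (by
      intro u v v'
      simp only [map_add, Metric.christoffelAt, christoffel_add_right]
      abel)
    (by
      intro c u v
      simp only [map_smul, Metric.christoffelAt, christoffel_smul_right, map_add, smul_add])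

theorem secondForm_eq [IsManifold (𝓡 k) ∞ S] (g : Metric n M) {ι : S → M}
    (hι : ContMDiff (𝓡 k) (𝓡 n) ∞ ι) (p : S) (u v : Euc k) :
    g.secondForm k ι p u v = g.secondFormBilin ι p u v := by
  have h : g.secondForm k ι p u v = g.normalProj (k := k) ι p
      (coordDeriv k ι (fun q => diffl k ι q
        (FiberBundle.extend (Euc k) (show TangentSpace (𝓡 k) p from v) q)) p u
        + g.christoffelAt (ι p) (diffl k ι p u) (diffl k ι p
          (FiberBundle.extend (Euc k) (show TangentSpace (𝓡 k) p from v) p))) := rfl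
  rw [h, coordDeriv_extend hι, FiberBundle.extend_apply_self]
  rfl

/-- The terms `df(u) v` and `df(v) u` of the difference of the connections are tangential, so that
only the normal part of `g(u, v) ∇f` survives. -/
theorem secondFormBilin_conformal (g : Metric n M) {f : M → ℝ}
    (hf : ContMDiff (𝓡 n) 𝓘(ℝ, ℝ) ∞ f) {ι : S → M} {p : S}
    (hinj : Function.Injective (diffl (n := n) k ι p)) (u v : Euc k) :
    (g.conformal f hf).secondFormBilin ι p u v = g.secondFormBilin ι p u v
      - g.induced k ι p u v • g.normalProj (k := k) ι p (g.gradVec f (ι p)) := by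
  simp only [Metric.secondFormBilin, LinearMap.mk₂_apply, normalProj_conformal g hf hinj,
    christoffelAt_conformal, map_add, map_sub, map_smul, normalProj_diffl g hinj, smul_zero,
    add_zero, induced_apply]
  abel

end

/-! ### The second variation integrand -/

section

variable {n k : ℕ}
  {M : Type*} [TopologicalSpace M] [ChartedSpace (Euc n) M] [IsManifold (𝓡 n) ∞ M]
  {S : Type*} [TopologicalSpace S] [ChartedSpace (Euc k) S]

/-- The integrand in terms of linear and bilinear maps of the coordinate spaces. -/
theorem secondVariation_eq [IsManifold (𝓡 k) ∞ S] (g : Metric n M) {ι : S → M}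
    (hι : ContMDiff (𝓡 k) (𝓡 n) ∞ ι) (V : S → Euc n) (p : S) :
    g.secondVariation k ι V p
      = metricTrace (g.induced k ι p) (fun u v => g.form (ι p)
          (g.normalProj (k := k) ι p (g.covAlong ι V p u))
          (g.normalProj (k := k) ι p (g.covAlong ι V p v)))
        - metricTrace (g.induced k ι p) (fun u v => g.form (ι p)
          (g.riemann (ι p) (V p) (diffl k ι p u) (V p)) (diffl k ι p v))
        - metricTrace (g.induced k ι p) (fun u u' => metricTrace (g.induced k ι p) (fun v v' =>
          g.form (ι p) (g.secondFormBilin ι p u v) (V p)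
            * g.form (ι p) (g.secondFormBilin ι p u' v') (V p))) := by
  simp only [← secondForm_eq g hι p]
  rfl

/-- If `Σ` is minimal for `e^{2f} g`, its mean curvature for `g` is `k (∇f)^⊥`. This is stated as
the product with a normal vector `W`. -/
theorem metricTrace_secondFormBilin_of_isMinimal [IsManifold (𝓡 k) ∞ S] (g : Metric n M)
    {f : M → ℝ} (hf : ContMDiff (𝓡 n) 𝓘(ℝ, ℝ) ∞ f) {ι : S → M} (hι : ContMDiff (𝓡 k) (𝓡 n) ∞ ι)
    {p : S} (hinj : Function.Injective (diffl (n := n) k ι p))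
    (hmin : (g.conformal f hf).meanCurvature k ι p = 0) {W : Euc n}
    (hW : ∀ u, g.form (ι p) W (diffl k ι p u) = 0) :
    metricTrace (g.induced k ι p) (fun u v => g.form (ι p) (g.secondFormBilin ι p u v) W)
      = k * funDeriv n f (ι p) W := by
  have hi := induced_isInvertible g hinj
  have h : ((g.conformal f hf).secondForm k ι p : Euc k → Euc k → Euc n)
      = fun u v => (g.conformal f hf).secondFormBilin ι p u v := by
    funext u v
    exact secondForm_eq _ hι p u v
  have h1 : metricTrace ((g.conformal f hf).induced k ι p)
      (fun u v => (g.conformal f hf).secondFormBilin ι p u v) = 0 := by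
    rw [← h]
    exact hmin
  rw [induced_conformal, metricTrace_smul_form hi (Real.exp_ne_zero _) (by simp)] at h1
  have h2 := (smul_eq_zero.1 h1).resolve_left (inv_ne_zero (Real.exp_ne_zero _))
  have h3 := map_metricTrace (h := g.induced k ι p) ((g.form (ι p)).flip W).toLinearMap
    (fun u v => (g.conformal f hf).secondFormBilin ι p u v)
  rw [h2, map_zero] at h3
  have h4 : (fun u v => ((g.form (ι p)).flip W).toLinearMap
        ((g.conformal f hf).secondFormBilin ι p u v))
      = fun u v => g.form (ι p) (g.secondFormBilin ι p u v) W
        - funDeriv n f (ι p) W * g.induced k ι p u v := by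
    funext u v
    rw [secondFormBilin_conformal g hf hinj]
    simp only [map_sub, map_smul, ContinuousLinearMap.coe_coe, ContinuousLinearMap.flip_apply,
      form_normalProj g hW, form_grad, smul_eq_mul, mul_comm]
  rw [h4, metricTrace_sub, metricTrace_const_mul, metricTrace_form hi (induced_symm g ι p)] at h3
  linarith

/-- The squared norm of `∇^⊤ f` is that of the restriction of `df` to the submanifold. -/
theorem form_tangential_grad (g : Metric n M) (f : M → ℝ) {ι : S → M} {p : S}
    (hinj : Function.Injective (diffl (n := n) k ι p)) :
    g.form (ι p) (g.tangential k ι p (g.grad f (ι p))) (g.tangential k ι p (g.grad f (ι p)))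
      = metricTrace (g.induced k ι p) (fun u v =>
          funDeriv n f (ι p) (diffl k ι p u) * funDeriv n f (ι p) (diffl k ι p v)) := by
  have hi := induced_isInvertible g hinj
  have hα : (g.form (ι p) (g.gradVec f (ι p))).comp (diffl k ι p)
      = (funDeriv n f (ι p)).comp (diffl k ι p) := by
    ext u
    exact form_grad g f (ι p) _
  change g.induced k ι p ((g.induced k ι p).inverse
      ((g.form (ι p) (g.gradVec f (ι p))).comp (diffl k ι p)))
    ((g.induced k ι p).inverse ((g.form (ι p) (g.gradVec f (ι p))).comp (diffl k ι p))) = _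
  rw [hα, hi.self_apply_inverse]
  exact (metricTrace_functional _ _).symm

theorem secondVariation_conformal {n k : ℕ}
    {M : Type*} [TopologicalSpace M] [ChartedSpace (Euc n) M] [IsManifold (𝓡 n) ∞ M]
    {S : Type*} [TopologicalSpace S] [ChartedSpace (Euc k) S] [IsManifold (𝓡 k) ∞ S]
    (g : Metric n M) {f : M → ℝ} (hf : ContMDiff (𝓡 n) 𝓘(ℝ, ℝ) ∞ f)
    {ι : S → M} (hι : ContMDiff (𝓡 k) (𝓡 n) ∞ ι) {p : S}
    (hinj : Function.Injective (diffl (n := n) k ι p))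
    (hmin : (g.conformal f hf).meanCurvature k ι p = 0) {V : S → Euc n}
    (hV : g.IsNormalSection k ι V) :
    (g.conformal f hf).secondVariation k ι (fun q => Real.exp (-f (ι q)) • V q) p
      = (g.secondVariation k ι V p
        - g.form (ι p) (g.tangential k ι p (g.grad f (ι p))) (g.tangential k ι p (g.grad f (ι p)))
          * g.form (ι p) (V p) (V p)
        + k * g.form (ι p) (g.covGrad f (ι p) (V p)) (V p)
        + k * g.form (ι p) (g.gradVec f (ι p)) (g.gradVec f (ι p)) * g.form (ι p) (V p) (V p)
        + g.divAlong k ι (g.grad f) p * g.form (ι p) (V p) (V p)) * Real.exp (-2 * f (ι p)) := by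
  have hi := induced_isInvertible g hinj
  have hsy := induced_symm (k := k) g ι p
  have hW : ∀ u : Euc k, g.form (ι p) (V p) (diffl k ι p u) = 0 := hV.inner_eq_zero p
  have hW' : ∀ u : Euc k, g.form (ι p) (diffl k ι p u) (V p) = 0 := fun u => by
    rw [form_symm, hW]
  have he : Real.exp (-2 * f (ι p)) = Real.exp (-f (ι p)) ^ 2 := by
    rw [← Real.exp_nat_mul]
    congr 1
    push_cast
    ring
  have hce : Real.exp (2 * f (ι p)) * Real.exp (-f (ι p)) ^ 2 = 1 := by
    rw [← he, ← Real.exp_add]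
    simp
  have hc := Real.exp_ne_zero (2 * f (ι p))
  rw [secondVariation_eq _ hι, secondVariation_eq _ hι, form_tangential_grad g f hinj, he]
  have hdiv : g.divAlong k ι (g.grad f) p = metricTrace (g.induced k ι p) (fun u v =>
      g.form (ι p) (g.covGrad f (ι p) (diffl k ι p u)) (diffl k ι p v)) := rfl
  rw [hdiv]
  simp only [normalProj_conformal g hf hinj, covAlong_conformal g hf hι hV.contMDiff, hW',
    zero_smul, sub_zero, map_smul, map_add, normalProj_diffl g hinj, smul_zero, add_zero,
    form_conformal, _root_.smul_apply, smul_eq_mul, riemann_smul, induced_conformal,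
    form_curvature_conformal g hf (ι p) (hW _) (hW _), secondFormBilin_conformal g hf hinj,
    map_sub, _root_.sub_apply, form_normalProj g hW, form_grad]
  -- All terms are now traces for `c h`, where `h` is the metric induced by `g` and `c = e^{2f}`, of
  -- expressions in `g`, with a factor `c` from each scalar product and two factors `e = e^{-f}`
  -- from `V`. A simple trace gets a factor `c⁻¹ = e²` and a double one `c⁻²`.
  have hmean := metricTrace_secondFormBilin_of_isMinimal g hf hι hinj hmin hW
  have htr := metricTrace_form hi hsy
  have hsq := metricTrace_sq_sub_smul_form hi hsy
    ((g.secondFormBilin (k := k) ι p).compr₂ ((g.form (ι p)).flip (V p)).toLinearMap)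
    (funDeriv n f (ι p) (V p))
  simp only [LinearMap.compr₂_apply, ContinuousLinearMap.coe_coe,
    ContinuousLinearMap.flip_apply, hmean] at hsq
  generalize Real.exp (2 * f (ι p)) = c at *
  generalize Real.exp (-f (ι p)) = e at *
  -- The square in the third term has a factor `(c e)²`, which is `c` as `c e² = 1`.
  have hthird : ∀ u u' v v' : Euc k,
      e * (c * g.form (ι p) (g.secondFormBilin ι p u v) (V p)
          - g.induced k ι p u v * (c * funDeriv n f (ι p) (V p)))
        * (e * (c * g.form (ι p) (g.secondFormBilin ι p u' v') (V p)
          - g.induced k ι p u' v' * (c * funDeriv n f (ι p) (V p))))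
      = c * ((g.form (ι p) (g.secondFormBilin ι p u v) (V p)
          - funDeriv n f (ι p) (V p) * g.induced k ι p u v)
        * (g.form (ι p) (g.secondFormBilin ι p u' v') (V p)
          - funDeriv n f (ι p) (V p) * g.induced k ι p u' v')) := by
    intro u u' v v'
    linear_combination (c * ((g.form (ι p) (g.secondFormBilin ι p u v) (V p)
          - funDeriv n f (ι p) (V p) * g.induced k ι p u v)
        * (g.form (ι p) (g.secondFormBilin ι p u' v') (V p)
          - funDeriv n f (ι p) (V p) * g.induced k ι p u' v'))) * hce
  simp only [hthird]
  have hinner : ∀ u u', metricTrace (c • g.induced k ι p) (fun v v' =>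
      c * ((g.form (ι p) (g.secondFormBilin ι p u v) (V p)
          - funDeriv n f (ι p) (V p) * g.induced k ι p u v)
        * (g.form (ι p) (g.secondFormBilin ι p u' v') (V p)
          - funDeriv n f (ι p) (V p) * g.induced k ι p u' v')))
      = metricTrace (g.induced k ι p) (fun v v' =>
        (g.form (ι p) (g.secondFormBilin ι p u v) (V p)
          - funDeriv n f (ι p) (V p) * g.induced k ι p u v)
        * (g.form (ι p) (g.secondFormBilin ι p u' v') (V p)
          - funDeriv n f (ι p) (V p) * g.induced k ι p u' v')) := by
    intro u u'
    rw [metricTrace_smul_form hi hc (by intros; simp; ring), metricTrace_const_mul, smul_eq_mul,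
      inv_mul_cancel_left₀ hc]
  simp only [hinner]
  rw [metricTrace_smul_form hi hc (by intros; simp; ring),
    metricTrace_smul_form hi hc (by intros; simp; ring),
    metricTrace_smul_form hi hc (by
      intro t u v
      rw [smul_eq_mul, ← metricTrace_const_mul]
      congr 1
      funext v v'
      simp
      ring), hsq]
  simp only [← induced_apply, metricTrace_sub, metricTrace_add, metricTrace_const_mul,
    metricTrace_mul_const, htr, smul_eq_mul]
  have he0 : e ≠ 0 := by
    rintro rfl
    simp at hce
  obtain rfl : c = (e ^ 2)⁻¹ := eq_inv_of_mul_eq_one_left hce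
  -- The contribution `k df(V)²` of the curvature cancels against the one of `hsq`.
  field_simp
  ring

end

end ConformalVariation

end

theorem corollary3p6 {n k : ℕ}
    {M : Type*} [TopologicalSpace M] [T2Space M] [CompactSpace M]
    [ChartedSpace (EuclideanSpace ℝ (Fin n)) M] [IsManifold (𝓡 n) ∞ M]
    {S : Type*} [TopologicalSpace S] [CompactSpace S]
    [ChartedSpace (EuclideanSpace ℝ (Fin k)) S] [IsManifold (𝓡 k) ∞ S]
    (g : ConformalVariation.Metric n M)
    (f : M → ℝ) (hf : ContMDiff (𝓡 n) 𝓘(ℝ, ℝ) ∞ f)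
    (ι : S → M) (hι : ContMDiff (𝓡 k) (𝓡 n) ∞ ι) (hemb : Topology.IsEmbedding ι)
    (hinj : ∀ p, Function.Injective (mfderiv (𝓡 k) (𝓡 n) ι p))
    (hmin : (g.conformal f hf).IsMinimal k ι)
    (V : ∀ p : S, TangentSpace (𝓡 n) (ι p)) (hV : g.IsNormalSection k ι V) (p : S) :
    (g.conformal f hf).secondVariation k ι (fun q => Real.exp (-f (ι q)) • V q) p =
      g.secondVariation k ι V p * Real.exp (-2 * f (ι p))
      - g.form (ι p) (g.tangential k ι p (g.grad f (ι p))) (g.tangential k ι p (g.grad f (ι p)))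
          * g.form (ι p) (V p) (V p) * Real.exp (-2 * f (ι p))
      + k * g.hess f (ι p) (V p) (V p) * Real.exp (-2 * f (ι p))
      + k * g.form (ι p) (g.grad f (ι p)) (g.grad f (ι p))
          * g.form (ι p) (V p) (V p) * Real.exp (-2 * f (ι p))
      + g.divAlong k ι (g.grad f) p * g.form (ι p) (V p) (V p) * Real.exp (-2 * f (ι p)) := by
  have h := ConformalVariation.secondVariation_conformal g hf hι (hinj p) (hmin p) hV
  refine h.trans ?_
  have hhess : g.hess f (ι p) (V p) (V p)
      = g.form (ι p) (g.covGrad f (ι p) (V p)) (V p) := rfl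
  rw [hhess]
  change _ = _ - _ + _
      + k * g.form (ι p) (g.gradVec f (ι p)) (g.gradVec f (ι p)) * _ * _ + _
  ring
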